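/- Let $G$ be a locally compact, $\sigma$-compact (Hausdorff) abelian group with Haar measure $|\cdot|$, acting continuously on a compact metric space $X$, the action being written $(t,x)\mapsto tx$. Let $(B_n)$ be a F\o lner sequence in $G$, i.e. each $B_n$ is a non-empty, open, relatively compact subset of $G$ and $|B_n\,\triangle\,(t+B_n)|/|B_n|\to 0$ as $n\to\infty$ for every $t\in G$. Let $\widehat G$ be the group of continuous homomorphisms $\xi:G\to\mathbb T=\{z\in\mathbb C:|z|=1\}$. For a bounded measurable function $h$ on $G$ put $\mathrm A(h)=\lim_{n}\frac1{|B_n|}\int_{B_n}h(t)\,dt$ if the limit exists and, for real $h$, $\overline M(h)=\limsup_{n}\frac1{|B_n|}\int_{B_n}h(t)\,dt$. For $f\in C(X)$ (continuous and complex-valued) and $x\in X$ let $f_x(t)=f(tx)$. A bounded measurable $h:G\to\mathbb C$ is Besicovitch almost periodic if for every $\varepsilon>0$ there are $k\in\mathbb N$, $\xi_1,\dots,\xi_k\in\widehat G$ and $c_1,\dots,c_k\in\mathbb C$ with $\overline M(|h-\sum_{j=1}^k c_j\xi_j|)<\varepsilon$. A point $x\in X$ is Besicovitch almost periodic if $f_x$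 is Besicovitch almost periodic for every $f\in C(X)$; its set of frequencies is $\mathrm{Freq}(x)=\{\xi\in\widehat G:\mathrm A(f_x\overline\xi)\neq0\text{ for some }f\in C(X)\}$. The point $x$ is generic for a probability measure $m$ on $X$ if $\mathrm A(f_x)=\int_X f\,dm$ for every $f\in C(X)$. For an invariant probability measure $m$, an eigenfunction with eigenvalue $\xi:G\to\mathbb C$ is an $f\in L^2(X,m)$, $f\ne0$, with $f(t\,\cdot)=\xi(t)f$ in $L^2(X,m)$ for all $t\in G$; $\mathrm{Eig}(X,G,m)$ is the set of all eigenvalues; $(X,G,m)$ has pure point spectrum if $L^2(X,m)$ has an orthonormal basis consisting of eigenfunctions. Theorem. Let $p\in X$ be a Besicovitch almost periodic point. Then $\mathrm A(f_p\overline\xi)$ exists for all $f\in C(X)$ and $\xi\in\widehat G$, and there is a unique ergodic invariant probability measure $m$ on $X$ for which $p$ is generic. The system $(X,G,m)$ has pure point spectrum and $\mathrm{Eig}(X,G,m)=\mathrm{Freq}(p)$. For each eigenvalue $\xi\in\mathrm{Eig}(X,G,m)$ there is a unique eigenfunction $e_\xi\in L^2(X,m)$ with eigenvalue $\xi$ such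 that $$\int_X f\,\overline{e_\xi}\,dm=\mathrm A(f_p\overline\xi)\qquad\text{for all }f\in C(X).$$ -/

import Mathlib

open MeasureTheory Filter Topology
open scoped Pointwise symmDiff ComplexConjugate ENNReal

/-- A Følner sequence in a locally compact group `G` with Haar measure `μ`: non-empty, open,
relatively compact sets `B n` with `|B n ∆ t B n| / |B n| → 0` for every `t`. -/
structure IsFolnerSeq {G : Type*} [Group G] [TopologicalSpace G] [MeasurableSpace G]
    (μ : Measure G) (B : ℕ → Set G) : Prop where
  isOpen : ∀ n, IsOpen (B n)
  relativelyCompact : ∀ n, IsCompact (closure (B n))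
  nonempty : ∀ n, (B n).Nonempty
  tendsto_zero : ∀ t : G,
    Tendsto (fun n => μ.real (B n ∆ (t • B n)) / μ.real (B n)) atTop (𝓝 0)

/-- The upper mean `limsup |B n|⁻¹ ∫_{B n} h` of a (bounded measurable) real function `h`. -/
noncomputable def upperMean {G : Type*} [MeasurableSpace G] (μ : Measure G) (B : ℕ → Set G)
    (h : G → ℝ) : ℝ :=
  limsup (fun n => ⨍ s in B n, h s ∂μ) atTop

/-- `HasMean μ B h a`: the limit `A(h) = lim |B n|⁻¹ ∫_{B n} h` exists and equals `a`. -/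
def HasMean {G : Type*} [MeasurableSpace G] (μ : Measure G) (B : ℕ → Set G)
    (h : G → ℂ) (a : ℂ) : Prop :=
  Tendsto (fun n => ⨍ s in B n, h s ∂μ) atTop (𝓝 a)

/-- A continuous character `ξ : G → 𝕋` of `G`, regarded as a complex valued function. -/
noncomputable def charToFun {G : Type*} [CommGroup G] [TopologicalSpace G] (ξ : PontryaginDual G) : G → ℂ :=
  fun t => (ξ t : ℂ)

/-- A bounded measurable function `f` on `G` is Besicovitch almost periodic if it can be
approximated by trigonometric polynomials with respect to the seminorm `upperMean |·|`. -/
def IsBesicovitchAP {G : Type*} [CommGroup G] [TopologicalSpace G] [MeasurableSpace G]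
    (μ : Measure G) (B : ℕ → Set G) (f : G → ℂ) : Prop :=
  Measurable f ∧ (∃ C : ℝ, ∀ t, ‖f t‖ ≤ C) ∧
    ∀ ε : ℝ, 0 < ε → ∃ (k : ℕ) (ξ : Fin k → PontryaginDual G) (c : Fin k → ℂ),
      upperMean μ B (fun t => ‖f t - ∑ j, c j * charToFun (ξ j) t‖) < ε

/-- The point `p` is Besicovitch almost periodic: all the functions `f_p : t ↦ f (t p)` with
`f` continuous on `X` are Besicovitch almost periodic. -/
def IsBesicovitchAPPoint {G X : Type*} [CommGroup G] [TopologicalSpace G] [MeasurableSpace G]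
    [TopologicalSpace X] [SMul G X] (μ : Measure G) (B : ℕ → Set G) (p : X) : Prop :=
  ∀ f : C(X, ℂ), IsBesicovitchAP μ B (fun t : G => f (t • p))

/-- The set of frequencies of `p`: all `ξ` in the dual group for which `A(f_p · conj ξ) ≠ 0` for
some continuous `f`. -/
def Freq {G X : Type*} [CommGroup G] [TopologicalSpace G] [MeasurableSpace G]
    [TopologicalSpace X] [SMul G X] (μ : Measure G) (B : ℕ → Set G) (p : X) :
    Set (PontryaginDual G) :=
  {ξ | ∃ (f : C(X, ℂ)) (a : ℂ),
    HasMean μ B (fun t => f (t • p) * conj (charToFun ξ t)) a ∧ a ≠ 0}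

/-- The point `p` is generic for the measure `m` with respect to the sequence `B`. -/
def IsGenericFor {G X : Type*} [MeasurableSpace G] [TopologicalSpace X] [MeasurableSpace X]
    [SMul G X] (μ : Measure G) (B : ℕ → Set G) (m : Measure X) (p : X) : Prop :=
  ∀ f : C(X, ℂ), HasMean μ B (fun t : G => f (t • p)) (∫ x, f x ∂m)

/-- `f ∈ L²(X, m)` is an eigenfunction with eigenvalue `χ : G → ℂ`: it is non-zero and
`f (t ·) = χ t • f` in `L²(X, m)` for every `t`. -/
def IsEigenfunctionFor {G X : Type*} [MeasurableSpace X] [SMul G X] (m : Measure X)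
    (χ : G → ℂ) (f : Lp ℂ 2 m) : Prop :=
  f ≠ 0 ∧ ∀ t : G, (fun x => f (t • x)) =ᵐ[m] fun x => χ t * f x

/-- The set of eigenvalues of `(X, G, m)`, as functions on `G`. -/
def Eig (G : Type*) {X : Type*} [MeasurableSpace X] [SMul G X] (m : Measure X) :
    Set (G → ℂ) :=
  {χ | ∃ f : Lp ℂ 2 m, IsEigenfunctionFor m χ f}

/-- `(X, G, m)` has pure point spectrum: `L²(X, m)` has an orthonormal basis consisting of
eigenfunctions. -/
def HasPurePointSpectrum (G : Type*) {X : Type*} [MeasurableSpace X] [SMul G X]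
    (m : Measure X) : Prop :=
  ∃ (s : Set (Lp ℂ 2 m)) (b : HilbertBasis s ℂ (Lp ℂ 2 m)),
    (∀ f : s, b f = f) ∧ ∀ f ∈ s, ∃ χ : G → ℂ, IsEigenfunctionFor m χ f

/-! By the Følner property, the mean of a character is 1 if it is trivial and 0 otherwise. So
trigonometric polynomials have means, and approximation gives the Fourier coefficients a(f, ξ) =
A(f_p ξ̄) (`IsBesicovitchAP.exists_hasMean`). The coefficients at ξ = 1 form a positive normalised
functional on C(X), and Riesz–Markov turns it into the measure m (`exists_isGenericFor`).

Genericity applied to |f|² says that the quadratic mean of f_p is the L²(m)-norm of f. Bessel's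
inequality then gives |a(f, ξ)| ≤ ‖f‖₂, so f ↦ a(f, ξ) is the inner product with a vector e_ξ of
norm at most 1 (`exists_fourierVector`). Invariance of means makes e_ξ satisfy the eigenvalue
equation for ξ (`koopman_fourierVector`), so the e_ξ are pairwise orthogonal; e_ξ ≠ 0 exactly when ξ
is a frequency.

The decisive point is that the e_ξ are total (`fourierVector_total`). If P = ∑ c_ξ ξ is close to f_p
in quadratic mean, expanding the squares shows that ∑ c_ξ e_ξ is at least as close to f in L²(m).
Since the hypothesis gives approximation only in the first mean, it is upgraded by truncation and
Stone–Weierstrass (`IsBesicovitchAP.exists_trigPoly_sq`). Totality yields everything else: a basis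
of eigenfunctions, no eigenvalues outside Freq(p), and ergodicity, since invariant functions are
multiples of e_1 = 1. -/

open BoundedContinuousFunction
open scoped InnerProductSpace

/-! ### Characters and the algebra of trigonometric polynomials -/

section Characters

variable {G : Type*} [CommGroup G] [TopologicalSpace G]

lemma continuous_charToFun (ξ : PontryaginDual G) : Continuous (charToFun ξ) :=
  continuous_subtype_val.comp (map_continuous ξ)

lemma norm_charToFun (ξ : PontryaginDual G) (t : G) : ‖charToFun ξ t‖ = 1 :=
  Circle.norm_coe _

lemma charToFun_map_mul (ξ : PontryaginDual G) (s t : G) :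
    charToFun ξ (s * t) = charToFun ξ s * charToFun ξ t := by
  simp [charToFun]

lemma charToFun_mul (ξ η : PontryaginDual G) (t : G) :
    charToFun (ξ * η) t = charToFun ξ t * charToFun η t :=
  Circle.coe_mul _ _

lemma charToFun_one (t : G) : charToFun (1 : PontryaginDual G) t = 1 := by
  simp [charToFun]

lemma charToFun_inv (ξ : PontryaginDual G) (t : G) :
    charToFun ξ⁻¹ t = conj (charToFun ξ t) :=
  Circle.coe_inv_eq_conj _

lemma charToFun_mul_conj (ξ : PontryaginDual G) (t : G) :
    charToFun ξ t * conj (charToFun ξ t) = 1 := by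
  rw [Complex.mul_conj, Complex.normSq_eq_norm_sq, norm_charToFun]
  norm_num

lemma charToFun_injective :
    Function.Injective (charToFun : PontryaginDual G → G → ℂ) := by
  intro ξ η h
  ext t
  exact congrFun h t

/-- A continuous character as a bounded continuous function. -/
noncomputable def charBCF (ξ : PontryaginDual G) : G →ᵇ ℂ :=
  BoundedContinuousFunction.ofNormedAddCommGroup (charToFun ξ) (continuous_charToFun ξ) 1
    fun t => (norm_charToFun ξ t).le

@[simp]
lemma charBCF_apply (ξ : PontryaginDual G) (t : G) : charBCF ξ t = charToFun ξ t := rfl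

lemma charBCF_mul (ξ η : PontryaginDual G) : charBCF (ξ * η) = charBCF ξ * charBCF η := by
  ext t
  exact charToFun_mul ξ η t

lemma charBCF_inv (ξ : PontryaginDual G) : charBCF ξ⁻¹ = star (charBCF ξ) := by
  ext t
  exact charToFun_inv ξ t

lemma charBCF_one : charBCF (1 : PontryaginDual G) = 1 := by
  ext t
  exact charToFun_one t

variable (G) in
/-- The star algebra of trigonometric polynomials. -/
noncomputable def trigPoly : StarSubalgebra ℂ (G →ᵇ ℂ) where
  carrier := Submodule.span ℂ (Set.range (charBCF (G := G)))
  add_mem' := Submodule.add_mem _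
  mul_mem' {a b} ha hb := by
    have h : Submodule.span ℂ (Set.range (charBCF (G := G))) *
        Submodule.span ℂ (Set.range (charBCF (G := G))) ≤
        Submodule.span ℂ (Set.range (charBCF (G := G))) := by
      rw [Submodule.span_mul_span, Submodule.span_le]
      rintro _ ⟨_, ⟨ξ, rfl⟩, _, ⟨η, rfl⟩, rfl⟩
      exact Submodule.subset_span ⟨ξ * η, charBCF_mul ξ η⟩
    exact h (Submodule.mul_mem_mul ha hb)
  algebraMap_mem' r := by
    rw [Algebra.algebraMap_eq_smul_one, ← charBCF_one]
    exact Submodule.smul_mem _ r (Submodule.subset_span ⟨1, rfl⟩)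
  star_mem' {a} ha := by
    induction ha using Submodule.span_induction with
    | mem x hx =>
      obtain ⟨ξ, rfl⟩ := hx
      exact Submodule.subset_span ⟨ξ⁻¹, charBCF_inv ξ⟩
    | zero => rw [star_zero]; exact Submodule.zero_mem _
    | add x y _ _ hx hy => rw [star_add]; exact Submodule.add_mem _ hx hy
    | smul c x _ hx => rw [star_smul]; exact Submodule.smul_mem _ _ hx

lemma mem_trigPoly_iff {P : G →ᵇ ℂ} :
    P ∈ trigPoly G ↔ ∃ c : PontryaginDual G →₀ ℂ, P = c.sum fun ξ a => a • charBCF ξ := by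
  simp only [eq_comm (a := P)]
  exact Finsupp.mem_span_range_iff_exists_finsupp

/-- Composing a trigonometric polynomial with a continuous function yields a uniform limit of
trigonometric polynomials. -/
lemma exists_trigPoly_near_comp {P : G →ᵇ ℂ} (hP : P ∈ trigPoly G) {φ : ℂ → ℂ}
    (hφ : Continuous φ) {δ : ℝ} (hδ : 0 < δ) :
    ∃ Q ∈ trigPoly G, ∀ t, ‖Q t - φ (P t)‖ ≤ δ := by
  set K : Set ℂ := Metric.closedBall 0 ‖P‖
  have : CompactSpace K := isCompact_iff_compactSpace.mp (isCompact_closedBall _ _)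
  let j : C(G, K) := ⟨fun t => ⟨P t, mem_closedBall_zero_iff.2 (P.norm_coe_le_norm t)⟩,
    P.continuous.subtype_mk _⟩
  let Φ : C(K, ℂ) → (G →ᵇ ℂ) := fun f => (mkOfCompact f).compContinuous j
  have hΦ : ∀ f g : C(K, ℂ), dist (Φ f) (Φ g) ≤ dist f g := fun f g =>
    (BoundedContinuousFunction.dist_le dist_nonneg).2 fun t => f.dist_apply_le_dist (j t)
  have hΦc : Continuous Φ := (LipschitzWith.of_dist_le' (K := 1) (by simpa using hΦ)).continuous
  -- Stone–Weierstrass: polynomials in z and its conjugate are dense in C(K), and `Φ f` is f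
  -- composed with P, so checking generators, operations and uniform limits suffices.
  have key : ∀ f : C(K, ℂ), Φ f ∈ (trigPoly G).topologicalClosure := by
    intro f
    induction f using ContinuousMap.induction_on_of_compact with
    | const r => exact algebraMap_mem _ r
    | id => exact (trigPoly G).le_topologicalClosure hP
    | star_id => exact star_mem ((trigPoly G).le_topologicalClosure hP)
    | add f g hf hg => exact add_mem hf hg
    | mul f g hf hg => exact mul_mem hf hg
    | frequently f hf =>
      have hcl : IsClosed {f : C(K, ℂ) | Φ f ∈ (trigPoly G).topologicalClosure} :=
        (StarSubalgebra.isClosed_topologicalClosure _).preimage hΦc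
      exact hcl.closure_subset (mem_closure_iff_frequently.2 hf)
  have hmem := key ((⟨φ, hφ⟩ : C(ℂ, ℂ)).restrict K)
  obtain ⟨Q, hQ, hd⟩ := Metric.mem_closure_iff.1 hmem δ hδ
  refine ⟨Q, hQ, fun t => ?_⟩
  rw [← dist_eq_norm, dist_comm]
  exact (BoundedContinuousFunction.dist_coe_le_dist t).trans hd.le

end Characters

/-! ### Truncation, for passing from first to quadratic mean -/

section Clip

/-- Truncation of the real and imaginary part of a complex number to `[-C, C]`. -/
noncomputable def complexClip (C : ℝ) (z : ℂ) : ℂ :=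
  ⟨max (-C) (min C z.re), max (-C) (min C z.im)⟩

lemma continuous_complexClip (C : ℝ) : Continuous (complexClip C) := by
  have : complexClip C = fun z => Complex.equivRealProdCLM.symm
      (max (-C) (min C z.re), max (-C) (min C z.im)) := rfl
  rw [this]
  fun_prop

/-- One factor of the square is bounded by |a - b|, because clipping is 1-Lipschitz and fixes a; the
other by 2C, because both points lie in [-C, C]. -/
lemma sq_sub_clip_le {C a b : ℝ} (ha : |a| ≤ C) :
    (a - max (-C) (min C b)) ^ 2 ≤ 2 * C * |a - b| := by
  obtain ⟨h1, h2⟩ := abs_le.1 ha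
  have h3 : |a - max (-C) (min C b)| ≤ |a - b| := by
    rcases max_cases (-C) (min C b) with ⟨h, h'⟩ | ⟨h, h'⟩ <;>
    rcases min_cases C b with ⟨k, k'⟩ | ⟨k, k'⟩ <;> rw [h] <;> try rw [k]
    all_goals
      rw [abs_le]
      rcases abs_cases (a - b) with ⟨e, e'⟩ | ⟨e, e'⟩ <;> constructor <;> linarith
  have h4 : |a - max (-C) (min C b)| ≤ 2 * C := by
    have h5 : -C ≤ max (-C) (min C b) := le_max_left _ _
    have h6 : max (-C) (min C b) ≤ C := max_le (by linarith) (min_le_left _ _)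
    rw [abs_le]; constructor <;> linarith
  rw [← sq_abs, sq]
  exact mul_le_mul h4 h3 (abs_nonneg _) (by linarith)

lemma norm_sub_complexClip_sq_le {C : ℝ} {z w : ℂ} (hz : ‖z‖ ≤ C) :
    ‖z - complexClip C w‖ ^ 2 ≤ 4 * C * ‖z - w‖ := by
  have h0 : 0 ≤ C := (norm_nonneg z).trans hz
  have h1 := sq_sub_clip_le (b := w.re) ((Complex.abs_re_le_norm z).trans hz)
  have h2 := sq_sub_clip_le (b := w.im) ((Complex.abs_im_le_norm z).trans hz)
  have h3 := mul_le_mul_of_nonneg_left (Complex.abs_re_le_norm (z - w)) (by positivity : 0 ≤ 2 * C)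
  have h4 := mul_le_mul_of_nonneg_left (Complex.abs_im_le_norm (z - w)) (by positivity : 0 ≤ 2 * C)
  rw [← Complex.normSq_eq_norm_sq, Complex.normSq_apply]
  simp only [complexClip, Complex.sub_re, Complex.sub_im] at *
  nlinarith

end Clip

/-! ### Means along a Følner sequence -/

section Means

variable {G : Type*} [MeasurableSpace G]

/-- The normalised restriction of `μ` to `B n`. -/
noncomputable def avgMeasure (μ : Measure G) (B : ℕ → Set G) (n : ℕ) : Measure G :=
  (μ (B n))⁻¹ • μ.restrict (B n)

lemma hasMean_iff {μ : Measure G} {B : ℕ → Set G} {h : G → ℂ} {a : ℂ} :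
    HasMean μ B h a ↔ Tendsto (fun n => ∫ s, h s ∂avgMeasure μ B n) atTop (𝓝 a) := by
  simp only [HasMean, setAverage_eq', avgMeasure]

lemma HasMean.unique {μ : Measure G} {B : ℕ → Set G} {h : G → ℂ} {a b : ℂ}
    (ha : HasMean μ B h a) (hb : HasMean μ B h b) : a = b :=
  tendsto_nhds_unique ha hb

variable [TopologicalSpace G]

lemma hasMean_smul {μ : Measure G} {B : ℕ → Set G} {h : G →ᵇ ℂ} {a : ℂ}
    (hh : HasMean μ B h a) (c : ℂ) :
    HasMean μ B (c • h : G →ᵇ ℂ) (c * a) := by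
  rw [hasMean_iff] at *
  refine (hh.const_mul c).congr fun n => ?_
  rw [← integral_const_mul]
  rfl

lemma hasMean_star {μ : Measure G} {B : ℕ → Set G} {h : G →ᵇ ℂ} {a : ℂ} (hh : HasMean μ B h a) :
    HasMean μ B (star h : G →ᵇ ℂ) (conj a) := by
  rw [hasMean_iff] at *
  refine ((Complex.continuous_conj.tendsto a).comp hh).congr fun n => ?_
  exact (integral_conj (f := h)).symm

variable [CommGroup G] {μ : Measure G} [μ.IsHaarMeasure] {B : ℕ → Set G}

lemma IsFolnerSeq.measure_ne_top (hB : IsFolnerSeq μ B) (n : ℕ) : μ (B n) ≠ ∞ :=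
  ((measure_mono subset_closure).trans_lt (hB.relativelyCompact n).measure_lt_top).ne

lemma IsFolnerSeq.measure_ne_zero (hB : IsFolnerSeq μ B) (n : ℕ) : μ (B n) ≠ 0 :=
  (hB.isOpen n).measure_ne_zero μ (hB.nonempty n)

lemma IsFolnerSeq.isProbabilityMeasure_avgMeasure (hB : IsFolnerSeq μ B) (n : ℕ) :
    IsProbabilityMeasure (avgMeasure μ B n) :=
  ⟨by simp [avgMeasure, ENNReal.inv_mul_cancel (hB.measure_ne_zero n) (hB.measure_ne_top n)]⟩

variable [BorelSpace G]

lemma hasMean_add {h k : G →ᵇ ℂ} {a b : ℂ} (hB : IsFolnerSeq μ B) (hh : HasMean μ B h a)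
    (hk : HasMean μ B k b) : HasMean μ B (h + k : G →ᵇ ℂ) (a + b) := by
  have := hB.isProbabilityMeasure_avgMeasure
  rw [hasMean_iff] at *
  refine (hh.add hk).congr fun n => ?_
  rw [← integral_add (h.integrable _) (k.integrable _)]
  rfl

lemma hasMean_sub {h k : G →ᵇ ℂ} {a b : ℂ} (hB : IsFolnerSeq μ B) (hh : HasMean μ B h a)
    (hk : HasMean μ B k b) : HasMean μ B (h - k : G →ᵇ ℂ) (a - b) := by
  have := hasMean_add hB hh (hasMean_smul hk (-1))
  simpa [sub_eq_add_neg] using this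

lemma hasMean_sum {ι : Type*} {S : Finset ι} {h : ι → G →ᵇ ℂ} {a : ι → ℂ} (hB : IsFolnerSeq μ B)
    (hh : ∀ i ∈ S, HasMean μ B (h i) (a i)) :
    HasMean μ B (∑ i ∈ S, h i : G →ᵇ ℂ) (∑ i ∈ S, a i) := by
  have := hB.isProbabilityMeasure_avgMeasure
  simp only [hasMean_iff] at *
  refine (tendsto_finsetSum S hh).congr fun n => ?_
  rw [← integral_finsetSum S fun i _ => (h i).integrable _]
  simp

/-- Means along a Følner sequence are translation invariant. -/
lemma IsFolnerSeq.tendsto_integral_translate_sub [IsTopologicalGroup G]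
    (hB : IsFolnerSeq μ B) (h : G →ᵇ ℂ) (t : G) :
    Tendsto (fun n => ∫ s, h (t * s) ∂avgMeasure μ B n - ∫ s, h s ∂avgMeasure μ B n)
      atTop (𝓝 0) := by
  have hlim := (hB.tendsto_zero t).const_mul ‖h‖
  rw [mul_zero] at hlim
  refine squeeze_zero_norm (fun n => ?_) hlim
  have hm := (hB.isOpen n).measurableSet
  have hm' : MeasurableSet (t • B n) := ((hB.isOpen n).smul t).measurableSet
  have htop := hB.measure_ne_top n
  have htop' : μ (t • B n) ≠ ∞ := by rwa [measure_smul]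
  have hint : ∀ A : Set G, μ A ≠ ∞ → IntegrableOn h A μ := fun A hA =>
    have : IsFiniteMeasure (μ.restrict A) := isFiniteMeasure_restrict.2 hA
    h.integrable _
  have h1 : ∫ s in B n, h (t * s) ∂μ = ∫ s in t • B n, h s ∂μ := by
    rw [← integral_indicator hm, ← integral_indicator hm',
      ← integral_mul_left_eq_self ((t • B n).indicator h) t]
    congr 1
    ext s
    by_cases hs : s ∈ B n
    · rw [Set.indicator_of_mem hs, Set.indicator_of_mem]
      exact Set.smul_mem_smul_set hs
    · rw [Set.indicator_of_notMem hs, Set.indicator_of_notMem]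
      rwa [← smul_eq_mul, Set.smul_mem_smul_set_iff]
  -- The integrals over the common part of the two sets cancel; only the symmetric difference
  -- remains.
  have h2 : ‖∫ s in t • B n, h s ∂μ - ∫ s in B n, h s ∂μ‖ ≤ ‖h‖ * μ.real (B n ∆ (t • B n)) := by
    have e1 := integral_inter_add_sdiff hm (hint _ htop')
    have e2 := integral_inter_add_sdiff hm' (hint _ htop)
    rw [Set.inter_comm] at e2
    rw [← e1, ← e2, add_sub_add_left_eq_sub, measureReal_symmDiff_eq hm hm' htop htop', mul_add,
      add_comm]
    refine (norm_sub_le _ _).trans (add_le_add ?_ ?_)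
    · exact norm_setIntegral_le_of_norm_le_const
        (measure_lt_top_of_subset Set.sdiff_subset htop') fun x _ => h.norm_coe_le_norm x
    · exact norm_setIntegral_le_of_norm_le_const
        (measure_lt_top_of_subset Set.sdiff_subset htop) fun x _ => h.norm_coe_le_norm x
  simp only [avgMeasure, integral_smul_measure, h1, ← smul_sub, norm_smul]
  rw [ENNReal.toReal_inv, norm_inv, Real.norm_of_nonneg ENNReal.toReal_nonneg, mul_div_assoc',
    div_eq_inv_mul]
  exact mul_le_mul_of_nonneg_left h2 (inv_nonneg.2 ENNReal.toReal_nonneg)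

lemma HasMean.translate [IsTopologicalGroup G] (hB : IsFolnerSeq μ B)
    {h : G →ᵇ ℂ} {a : ℂ} (hh : HasMean μ B h a) (t : G) :
    HasMean μ B (fun s => h (t * s)) a := by
  rw [hasMean_iff] at *
  simpa using (hB.tendsto_integral_translate_sub h t).add hh

/-- Translating by t multiplies the averages of ξ by ξ(t), yet changes them by o(1); if ξ(t) ≠ 1
they must tend to 0. -/
lemma hasMean_char [IsTopologicalGroup G] (hB : IsFolnerSeq μ B)
    (ξ : PontryaginDual G) [Decidable (ξ = 1)] :
    HasMean μ B (charBCF ξ) (if ξ = 1 then 1 else 0) := by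
  have := hB.isProbabilityMeasure_avgMeasure
  rw [hasMean_iff]
  split_ifs with hξ
  · simp [hξ, charBCF_one]
  · obtain ⟨t, ht⟩ : ∃ t, charToFun ξ t ≠ 1 := by
      by_contra! H
      exact hξ (charToFun_injective (funext fun t => by rw [H, charToFun_one]))
    have h1 := hB.tendsto_integral_translate_sub (charBCF ξ) t
    have h2 := h1.const_mul (charToFun ξ t - 1)⁻¹
    rw [mul_zero] at h2
    refine h2.congr fun n => ?_
    simp only [charBCF_apply, charToFun_map_mul, integral_const_mul]
    have : charToFun ξ t - 1 ≠ 0 := sub_ne_zero.2 ht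
    field_simp

end Means

/-! ### Fourier coefficients and quadratic approximation of Besicovitch almost periodic functions -/

section BesicovitchAP

variable {G : Type*} [TopologicalSpace G] [MeasurableSpace G] {μ : Measure G} {B : ℕ → Set G}

lemma integral_mul_star (ν : Measure G) (k : G →ᵇ ℂ) :
    ∫ s, (k * star k : G →ᵇ ℂ) s ∂ν = ((∫ s, ‖k s‖ ^ 2 ∂ν : ℝ) : ℂ) := by
  rw [← integral_complex_ofReal]
  congr 1
  ext s
  simp [Complex.mul_conj, Complex.normSq_eq_norm_sq]

lemma tendsto_of_hasMean_mul_star {k : G →ᵇ ℂ} {b : ℂ}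
    (hb : HasMean μ B (k * star k : G →ᵇ ℂ) b) :
    Tendsto (fun n => ∫ s, ‖k s‖ ^ 2 ∂avgMeasure μ B n) atTop (𝓝 b.re) := by
  refine ((Complex.continuous_re.tendsto b).comp (hasMean_iff.1 hb)).congr fun n => ?_
  simp only [Function.comp, integral_mul_star, Complex.ofReal_re]

lemma integral_norm_le_norm [BorelSpace G] {ν : Measure G} [IsProbabilityMeasure ν] (k : G →ᵇ ℂ) :
    ∫ s, ‖k s‖ ∂ν ≤ ‖k‖ := by
  refine (integral_mono (k.integrable ν).norm (integrable_const ‖k‖) k.norm_coe_le_norm).trans ?_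
  simp

variable [CommGroup G] [BorelSpace G] [μ.IsHaarMeasure] {h : G →ᵇ ℂ}

lemma IsBesicovitchAP.exists_trigPoly (hB : IsFolnerSeq μ B) (hh : IsBesicovitchAP μ B h)
    {ε : ℝ} (hε : 0 < ε) :
    ∃ P ∈ trigPoly G, ∀ᶠ n in atTop, ∫ s, ‖h s - P s‖ ∂avgMeasure μ B n < ε := by
  have := hB.isProbabilityMeasure_avgMeasure
  obtain ⟨k, ξ, c, hlim⟩ := hh.2.2 ε hε
  refine ⟨∑ j, c j • charBCF (ξ j), sum_mem fun j _ => SMulMemClass.smul_mem _ ?_, ?_⟩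
  · exact Submodule.subset_span ⟨ξ j, rfl⟩
  -- A real `limsup` has a default value on sequences unbounded above; this bound makes it
  -- meaningful.
  · have hb : ∀ n, ∫ s, ‖(h - ∑ j, c j • charBCF (ξ j)) s‖ ∂avgMeasure μ B n ≤
        ‖h - ∑ j, c j • charBCF (ξ j)‖ := fun n => integral_norm_le_norm _
    simp only [upperMean, setAverage_eq'] at hlim
    simp only [BoundedContinuousFunction.sub_apply, BoundedContinuousFunction.coe_sum,
      Finset.sum_apply, BoundedContinuousFunction.coe_smul, smul_eq_mul, charBCF_apply] at hb ⊢
    exact eventually_lt_of_limsup_lt hlim (isBoundedUnder_of ⟨_, hb⟩)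

/-- For bounded functions, Besicovitch almost periodicity yields approximation by trigonometric
polynomials in quadratic mean. -/
lemma IsBesicovitchAP.exists_trigPoly_sq (hB : IsFolnerSeq μ B) (hh : IsBesicovitchAP μ B h)
    {ε : ℝ} (hε : 0 < ε) :
    ∃ P ∈ trigPoly G, ∀ᶠ n in atTop, ∫ s, ‖h s - P s‖ ^ 2 ∂avgMeasure μ B n ≤ ε := by
  have := hB.isProbabilityMeasure_avgMeasure
  have hC := norm_nonneg h
  -- The constants make each of the two contributions in `hpt` at most ε/2; the summand 1 covers h =
  -- 0.
  obtain ⟨P, hP, hPn⟩ := hh.exists_trigPoly hB (ε := ε / (16 * (‖h‖ + 1))) (by positivity)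
  obtain ⟨Q, hQ, hQP⟩ := exists_trigPoly_near_comp hP (continuous_complexClip ‖h‖)
    (δ := √ε / 2) (by positivity)
  refine ⟨Q, hQ, hPn.mono fun n hn => ?_⟩
  have hpt : ∀ s, ‖h s - Q s‖ ^ 2 ≤ 8 * ‖h‖ * ‖h s - P s‖ + ε / 2 := by
    intro s
    have h1 := norm_sub_complexClip_sq_le (w := P s) (h.norm_coe_le_norm s)
    have h2 : ‖Q s - complexClip ‖h‖ (P s)‖ ^ 2 ≤ ε / 4 := by
      refine (pow_le_pow_left₀ (norm_nonneg _) (hQP s) 2).trans_eq ?_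
      rw [div_pow, Real.sq_sqrt hε.le]
      norm_num
    have h3 : ‖h s - Q s‖ ≤
        ‖h s - complexClip ‖h‖ (P s)‖ + ‖Q s - complexClip ‖h‖ (P s)‖ := by
      rw [norm_sub_rev (Q s)]
      exact norm_sub_le_norm_sub_add_norm_sub _ _ _
    have h4 := pow_le_pow_left₀ (norm_nonneg _) h3 2
    nlinarith [sq_nonneg (‖h s - complexClip ‖h‖ (P s)‖ - ‖Q s - complexClip ‖h‖ (P s)‖)]
  have hi1 : Integrable (fun s => ‖h s - P s‖) (avgMeasure μ B n) := ((h - P).integrable _).norm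
  have hi2 : Integrable (fun s => ‖h s - Q s‖ ^ 2) (avgMeasure μ B n) := by
    refine (((h - Q) * star (h - Q)).integrable (avgMeasure μ B n)).norm.congr (ae_of_all _ ?_)
    intro s
    simp only [BoundedContinuousFunction.mul_apply, BoundedContinuousFunction.star_apply,
      BoundedContinuousFunction.sub_apply, norm_mul, norm_star, sq]
  refine (integral_mono hi2 ((hi1.const_mul _).add (integrable_const _)) hpt).trans ?_
  rw [integral_add' (hi1.const_mul _) (integrable_const _), integral_const_mul]
  have h5 : 8 * ‖h‖ * ∫ s, ‖h s - P s‖ ∂avgMeasure μ B n ≤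
      8 * (‖h‖ + 1) * (ε / (16 * (‖h‖ + 1))) := by
    exact mul_le_mul (by linarith) hn.le (integral_nonneg fun _ => norm_nonneg _) (by positivity)
  have h6 : 8 * (‖h‖ + 1) * (ε / (16 * (‖h‖ + 1))) = ε / 2 := by
    field_simp
    norm_num
  simp only [integral_const, probReal_univ, one_smul]
  linarith

variable [IsTopologicalGroup G]

lemma exists_hasMean_of_mem_trigPoly (hB : IsFolnerSeq μ B) {P : G →ᵇ ℂ} (hP : P ∈ trigPoly G) :
    ∃ a, HasMean μ B P a := by
  classical
  obtain ⟨c, rfl⟩ := mem_trigPoly_iff.1 hP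
  exact ⟨_, hasMean_sum hB fun ξ _ => hasMean_smul (hasMean_char hB ξ) (c ξ)⟩

/-- The averages of h are Cauchy, being eventually within ε/3 of the convergent averages of P. -/
lemma exists_hasMean_of_approx (hB : IsFolnerSeq μ B)
    (hh : ∀ ε : ℝ, 0 < ε → ∃ P ∈ trigPoly G,
      ∀ᶠ n in atTop, ∫ s, ‖h s - P s‖ ∂avgMeasure μ B n < ε) :
    ∃ a, HasMean μ B h a := by
  have := hB.isProbabilityMeasure_avgMeasure
  simp only [hasMean_iff]
  refine cauchySeq_tendsto_of_complete (Metric.cauchySeq_iff.2 fun ε hε => ?_)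
  obtain ⟨P, hP, hPn⟩ := hh (ε / 3) (by positivity)
  obtain ⟨a, ha⟩ := exists_hasMean_of_mem_trigPoly hB hP
  obtain ⟨N₁, hN₁⟩ := Metric.cauchySeq_iff.1 (hasMean_iff.1 ha).cauchySeq (ε / 3) (by positivity)
  obtain ⟨N₂, hN₂⟩ := eventually_atTop.1 hPn
  have hd : ∀ n ≥ N₂, dist (∫ s, h s ∂avgMeasure μ B n) (∫ s, P s ∂avgMeasure μ B n) < ε / 3 := by
    intro n hn
    rw [dist_eq_norm, ← integral_sub (h.integrable _) (P.integrable _)]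
    exact (norm_integral_le_integral_norm _).trans_lt (hN₂ n hn)
  refine ⟨max N₁ N₂, fun m hm n hn => ?_⟩
  have h1 := hN₁ m (le_of_max_le_left hm) n (le_of_max_le_left hn)
  have h2 := hd m (le_of_max_le_right hm)
  have h3 := hd n (le_of_max_le_right hn)
  rw [dist_comm] at h3
  linarith [dist_triangle4 (∫ s, h s ∂avgMeasure μ B m) (∫ s, P s ∂avgMeasure μ B m)
    (∫ s, P s ∂avgMeasure μ B n) (∫ s, h s ∂avgMeasure μ B n)]

/-- Fourier coefficients of Besicovitch almost periodic functions exist. -/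
lemma IsBesicovitchAP.exists_hasMean (hB : IsFolnerSeq μ B) (hh : IsBesicovitchAP μ B h)
    (ξ : PontryaginDual G) : ∃ a, HasMean μ B (h * star (charBCF ξ) : G →ᵇ ℂ) a := by
  refine exists_hasMean_of_approx hB fun ε hε => ?_
  obtain ⟨P, hP, hPn⟩ := hh.exists_trigPoly hB hε
  refine ⟨P * star (charBCF ξ), mul_mem hP (star_mem (Submodule.subset_span ⟨ξ, rfl⟩)), ?_⟩
  refine hPn.mono fun n hn => ?_
  convert hn using 3 with s
  simp [← sub_mul, norm_charToFun]

/-- Expand the square; orthonormality of the characters in mean reduces the double sum to its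
diagonal. The form of the limit matches `norm_sub_sum_sq_le_of_orthogonal`. -/
lemma hasMean_sub_trigPoly_sq (hB : IsFolnerSeq μ B) {a : PontryaginDual G → ℂ} {M : ℂ}
    (ha : ∀ ξ, HasMean μ B (h * star (charBCF ξ) : G →ᵇ ℂ) (a ξ))
    (hM : HasMean μ B (h * star h : G →ᵇ ℂ) M) (S : Finset (PontryaginDual G))
    (c : PontryaginDual G → ℂ) :
    HasMean μ B ((h - ∑ ξ ∈ S, c ξ • charBCF ξ) * star (h - ∑ ξ ∈ S, c ξ • charBCF ξ) : G →ᵇ ℂ)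
      (M - ∑ ξ ∈ S, conj (c ξ) * a ξ - ∑ ξ ∈ S, c ξ * conj (a ξ) +
        ∑ ξ ∈ S, c ξ * conj (c ξ)) := by
  classical
  have h1 := hasMean_sum hB (S := S) fun ξ _ => hasMean_smul (ha ξ) (conj (c ξ))
  have h2 := hasMean_sum hB (S := S) fun ξ _ => hasMean_smul (hasMean_star (ha ξ)) (c ξ)
  have h3 := hasMean_sum hB (S := S) fun ξ _ => hasMean_smul (hasMean_sum hB (S := S) fun η _ =>
    hasMean_smul (hasMean_char hB (ξ * η⁻¹)) (conj (c η))) (c ξ)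
  have h4 := hasMean_add hB (hasMean_sub hB (hasMean_sub hB hM h1) h2) h3
  convert h4 using 1
  · congr 1
    simp only [star_sub, star_sum, star_smul, star_mul, star_star, charBCF_mul, charBCF_inv,
      sub_mul, mul_sub, smul_sub, Finset.sum_sub_distrib, Finset.mul_sum, Finset.sum_mul,
      Finset.smul_sum, smul_mul_assoc,
      mul_smul_comm, RCLike.star_def]
    rw [Finset.sum_comm (s := S) (t := S)]
    simp only [smul_comm (c _) (conj (c _))]
    abel
  · congr 1
    refine Finset.sum_congr rfl fun ξ hξ => ?_
    simp only [mul_inv_eq_one, mul_ite, mul_one, mul_zero]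
    rw [Finset.sum_ite_eq S ξ (fun η => conj (c η)), if_pos hξ]

/-- Bessel's inequality for a single Fourier coefficient. -/
lemma norm_sq_le_of_hasMean (hB : IsFolnerSeq μ B) {a : PontryaginDual G → ℂ} {M : ℂ}
    (ha : ∀ ξ, HasMean μ B (h * star (charBCF ξ) : G →ᵇ ℂ) (a ξ))
    (hM : HasMean μ B (h * star h : G →ᵇ ℂ) M) (ξ : PontryaginDual G) :
    ‖a ξ‖ ^ 2 ≤ M.re := by
  -- For S = {ξ} and c = a the limit is M - |a ξ|², a limit of non-negative averages.
  have h1 := ge_of_tendsto' (tendsto_of_hasMean_mul_star (hasMean_sub_trigPoly_sq hB ha hM {ξ} a))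
    fun n => integral_nonneg fun s => sq_nonneg _
  simp only [Finset.sum_singleton, mul_comm (conj (a ξ)), sub_add_cancel, Complex.mul_conj,
    Complex.sub_re, Complex.ofReal_re, Complex.normSq_eq_norm_sq] at h1
  linarith

end BesicovitchAP

/-! ### The measure for which p is generic -/

section GenericMeasure

/-- A normalised positive linear functional on the real continuous functions of a compact space is
given by a probability measure. -/
lemma exists_isProbabilityMeasure_integral_eq {X : Type*} [TopologicalSpace X] [T2Space X]
    [CompactSpace X] [MeasurableSpace X] [BorelSpace X] (Λ : C(X, ℝ) →ₗ[ℝ] ℝ)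
    (hpos : ∀ f : C(X, ℝ), 0 ≤ f → 0 ≤ Λ f) (hone : Λ 1 = 1) :
    ∃ m : Measure X, IsProbabilityMeasure m ∧ ∀ f : C(X, ℝ), ∫ x, f x ∂m = Λ f := by
  let L : CompactlySupportedContinuousMap X ℝ →ₗ[ℝ] ℝ :=
    { toFun := fun f => Λ f.toContinuousMap
      map_add' := fun f g => Λ.map_add f.toContinuousMap g.toContinuousMap
      map_smul' := fun c f => Λ.map_smul c f.toContinuousMap }
  let L' : CompactlySupportedContinuousMap X ℝ →ₚ[ℝ] ℝ :=
    PositiveLinearMap.mk₀ L fun f hf => hpos f.toContinuousMap hf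
  have key : ∀ f : C(X, ℝ), ∫ x, f x ∂(RealRMK.rieszMeasure L') = Λ f := fun f =>
    RealRMK.integral_rieszMeasure L' (CompactlySupportedContinuousMap.continuousMapEquiv f)
  refine ⟨RealRMK.rieszMeasure L', ⟨?_⟩, key⟩
  have h1 := key 1
  rw [hone] at h1
  simp only [ContinuousMap.one_apply, integral_const, smul_eq_mul, mul_one] at h1
  exact (ENNReal.toReal_eq_one_iff _).1 h1

/-- A real continuous function as a complex one. -/
noncomputable def complexCM {X : Type*} [TopologicalSpace X] (f : C(X, ℝ)) : C(X, ℂ) :=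
  ⟨fun x => (f x : ℂ), by fun_prop⟩

@[simp]
lemma complexCM_apply {X : Type*} [TopologicalSpace X] (f : C(X, ℝ)) (x : X) :
    complexCM f x = (f x : ℂ) := rfl

/-- Gives both the uniqueness of m and, applied to push-forwards, its invariance. -/
lemma IsGenericFor.ext {G X : Type*} [MeasurableSpace G] [TopologicalSpace X] [MeasurableSpace X]
    [SMul G X] [HasOuterApproxClosed X] [BorelSpace X] {μ : Measure G} {B : ℕ → Set G} {p : X}
    {m m' : Measure X}
    [IsFiniteMeasure m] [IsFiniteMeasure m'] (hm : IsGenericFor μ B m p)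
    (hm' : IsGenericFor μ B m' p) : m = m' := by
  refine ext_of_forall_integral_eq_of_IsFiniteMeasure fun f => ?_
  have h := (hm (complexCM f.toContinuousMap)).unique (hm' (complexCM f.toContinuousMap))
  simp only [complexCM_apply, integral_complex_ofReal] at h
  exact_mod_cast h

variable {G X : Type*} [CommGroup G] [TopologicalSpace G] [TopologicalSpace X]
  [MulAction G X] [ContinuousSMul G X]

/-- The translate `x ↦ f (t x)` of a continuous function. -/
noncomputable def translateCM (t : G) (f : C(X, ℂ)) : C(X, ℂ) := f.comp ⟨fun x => t • x, by fun_prop⟩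

@[simp]
lemma translateCM_apply (t : G) (f : C(X, ℂ)) (x : X) : translateCM t f x = f (t • x) := rfl

variable [CompactSpace X]

/-- The function `t ↦ f (t p)` on the group. -/
noncomputable def orbitBCF (p : X) (f : C(X, ℂ)) : G →ᵇ ℂ :=
  (mkOfCompact f).compContinuous ⟨fun t : G => t • p, by fun_prop⟩

@[simp]
lemma orbitBCF_apply (p : X) (f : C(X, ℂ)) (t : G) : orbitBCF p f t = f (t • p) := rfl

variable [MeasurableSpace G] [BorelSpace G] [MeasurableSpace X]
  {μ : Measure G} [μ.IsHaarMeasure] {B : ℕ → Set G} {p : X}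

lemma exists_isGenericFor [T2Space X] [BorelSpace X] (hB : IsFolnerSeq μ B)
    (h : ∀ f : C(X, ℂ), ∃ a, HasMean μ B (orbitBCF p f) a) :
    ∃ m : Measure X, IsProbabilityMeasure m ∧ IsGenericFor μ B m p := by
  have := hB.isProbabilityMeasure_avgMeasure
  choose a ha using h
  have hre : ∀ f : C(X, ℝ), Tendsto (fun n => ∫ s : G, f (s • p) ∂avgMeasure μ B n) atTop
      (𝓝 (a (complexCM f)).re) := by
    intro f
    refine ((Complex.continuous_re.tendsto _).comp
      (hasMean_iff.1 (ha (complexCM f)))).congr fun n => ?_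
    simp only [Function.comp, orbitBCF_apply, complexCM_apply]
    rw [integral_complex_ofReal, Complex.ofReal_re]
  have hint : ∀ (f : C(X, ℝ)) n, Integrable (fun s : G => f (s • p)) (avgMeasure μ B n) :=
    fun f n => ((mkOfCompact f).compContinuous ⟨fun t : G => t • p, by fun_prop⟩).integrable _
  let Λ : C(X, ℝ) →ₗ[ℝ] ℝ :=
    { toFun := fun f => (a (complexCM f)).re
      map_add' := fun f g => tendsto_nhds_unique (hre (f + g))
        (((hre f).add (hre g)).congr fun n => (integral_add (hint f n) (hint g n)).symm)
      map_smul' := fun c f => tendsto_nhds_unique (hre (c • f))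
        (((hre f).const_mul c).congr fun n => (integral_const_mul _ _).symm) }
  obtain ⟨m, hm, hΛ⟩ := exists_isProbabilityMeasure_integral_eq Λ
    (fun f hf => ge_of_tendsto' (hre f) fun n => integral_nonneg fun s => hf (s • p))
    (tendsto_nhds_unique (hre 1) (by simp))
  refine ⟨m, hm, fun f => ?_⟩
  let fr : C(X, ℝ) := ⟨fun x => (f x).re, by fun_prop⟩
  let fi : C(X, ℝ) := ⟨fun x => (f x).im, by fun_prop⟩
  have hint' : ∀ g : C(X, ℝ), Integrable (fun x => g x) m := fun g =>
    (mkOfCompact g).integrable _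
  have h1 : ∫ x, f x ∂m = ((Λ fr : ℝ) : ℂ) + ((Λ fi : ℝ) : ℂ) * Complex.I := by
    rw [← hΛ, ← hΛ, ← integral_complex_ofReal, ← integral_complex_ofReal, ← integral_mul_const,
      ← integral_add (hint' fr).ofReal ((hint' fi).ofReal.mul_const _)]
    exact integral_congr_ae (ae_of_all _ fun x => (Complex.re_add_im _).symm)
  rw [h1, hasMean_iff]
  refine (((Complex.continuous_ofReal.tendsto _).comp (hre fr)).add
    (((Complex.continuous_ofReal.tendsto _).comp (hre fi)).mul_const Complex.I)).congr fun n => ?_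
  simp only [Function.comp]
  rw [← integral_complex_ofReal, ← integral_complex_ofReal, ← integral_mul_const,
    ← integral_add (hint fr n).ofReal ((hint fi n).ofReal.mul_const _)]
  exact integral_congr_ae (ae_of_all _ fun x => Complex.re_add_im _)

lemma IsGenericFor.smulInvariantMeasure [IsTopologicalGroup G] [HasOuterApproxClosed X] [BorelSpace X]
    (hB : IsFolnerSeq μ B) {m : Measure X} [IsFiniteMeasure m] (hm : IsGenericFor μ B m p) :
    SMulInvariantMeasure G X m := by
  refine ⟨fun t s hs => ?_⟩
  have hc : Continuous fun x : X => t • x := by fun_prop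
  have hmap : m.map (fun x => t • x) = m := by
    -- The push-forward is also generic for p, since f_p and its translate by t have the same mean.
    refine IsGenericFor.ext (μ := μ) (B := B) (p := p) (fun f => ?_) hm
    have h1 := hm (translateCM t f)
    rw [integral_map hc.aemeasurable f.continuous.measurable.aestronglyMeasurable]
    have h2 := HasMean.translate hB (h := orbitBCF p f) (hm f) t
    simp only [orbitBCF_apply, mul_smul] at h2
    simp only [translateCM_apply] at h1
    rw [h1.unique h2]
    exact hm f
  conv_rhs => rw [← hmap, Measure.map_apply hc.measurable hs]

end GenericMeasure

/-! ### Orthogonal families in Hilbert space -/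

section Hilbert

variable {ι H : Type*} [NormedAddCommGroup H] [InnerProductSpace ℂ H]

/-- Normalising the non-zero members of a total orthogonal family gives an orthonormal basis. -/
lemma exists_hilbertBasis_of_orthogonal [CompleteSpace H] {e : ι → H}
    (horth : ∀ i j, i ≠ j → ⟪e i, e j⟫_ℂ = 0)
    (htot : ∀ v : H, (∀ i, ⟪e i, v⟫_ℂ = 0) → v = 0) :
    ∃ (s : Set H) (b : HilbertBasis s ℂ H), (∀ f : s, b f = f) ∧
      ∀ f ∈ s, ∃ (i : ι) (c : ℂ), f ≠ 0 ∧ f = c • e i := by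
  let u : {i // e i ≠ 0} → H := fun i => ((‖e i‖⁻¹ : ℝ) : ℂ) • e i
  have hne : ∀ i : {i // e i ≠ 0}, ‖e i‖ ≠ 0 := fun i => norm_ne_zero_iff.2 i.2
  have hu : Orthonormal ℂ u := by
    refine ⟨fun i => ?_, fun i j hij => ?_⟩
    · simp only [u, norm_smul, Complex.norm_real, norm_inv, norm_norm]
      exact inv_mul_cancel₀ (hne i)
    · simp only [u, inner_smul_left, inner_smul_right,
        horth _ _ (Subtype.coe_injective.ne hij), mul_zero]
  have hsub := hu.toSubtypeRange
  refine ⟨Set.range u, HilbertBasis.mkOfOrthogonalEqBot hsub ?_, fun f => ?_, ?_⟩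
  · rw [Submodule.eq_bot_iff]
    intro v hv
    refine htot v fun i => ?_
    by_cases hi : e i = 0
    · rw [hi, inner_zero_left]
    · have h1 := (Submodule.mem_orthogonal _ v).1 hv (u ⟨i, hi⟩)
        (Submodule.subset_span ⟨⟨_, ⟨i, hi⟩, rfl⟩, rfl⟩)
      simp only [u, inner_smul_left, mul_eq_zero, map_eq_zero, Complex.ofReal_eq_zero,
        inv_eq_zero] at h1
      exact h1.resolve_left (hne ⟨i, hi⟩)
  · rw [HilbertBasis.coe_mkOfOrthogonalEqBot]
  · rintro _ ⟨i, rfl⟩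
    exact ⟨i, _, hu.ne_zero i, rfl⟩

/-- The expansion is exact except for the diagonal terms |c i|²‖e i‖², where ‖e i‖ ≤ 1 enters. Thus
the e i need not be normalised and may vanish. -/
lemma norm_sub_sum_sq_le_of_orthogonal {e : ι → H} (horth : ∀ i j, i ≠ j → ⟪e i, e j⟫_ℂ = 0)
    (hnorm : ∀ i, ‖e i‖ ≤ 1) (F : H) (S : Finset ι) (c : ι → ℂ) :
    ‖F - ∑ i ∈ S, c i • e i‖ ^ 2 ≤
      (⟪F, F⟫_ℂ - ∑ i ∈ S, conj (c i) * ⟪e i, F⟫_ℂ - ∑ i ∈ S, c i * conj ⟪e i, F⟫_ℂ +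
        ∑ i ∈ S, c i * conj (c i)).re := by
  classical
  have h1 : ⟪F - ∑ i ∈ S, c i • e i, F - ∑ i ∈ S, c i • e i⟫_ℂ =
      ⟪F, F⟫_ℂ - ∑ i ∈ S, conj (c i) * ⟪e i, F⟫_ℂ - ∑ i ∈ S, c i * conj ⟪e i, F⟫_ℂ +
        ∑ i ∈ S, c i * conj (c i) * ⟪e i, e i⟫_ℂ := by
    have h2 : ⟪∑ i ∈ S, c i • e i, F⟫_ℂ = ∑ i ∈ S, conj (c i) * ⟪e i, F⟫_ℂ := by
      simp only [sum_inner, inner_smul_left]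
    have h3 : ⟪F, ∑ i ∈ S, c i • e i⟫_ℂ = ∑ i ∈ S, c i * conj ⟪e i, F⟫_ℂ := by
      simp only [inner_sum, inner_smul_right, inner_conj_symm]
    have h4 : ⟪∑ i ∈ S, c i • e i, ∑ i ∈ S, c i • e i⟫_ℂ =
        ∑ i ∈ S, c i * conj (c i) * ⟪e i, e i⟫_ℂ := by
      simp only [sum_inner, inner_sum, inner_smul_left, inner_smul_right]
      refine Finset.sum_congr rfl fun i hi => ?_
      rw [Finset.sum_eq_single_of_mem i hi fun j _ hj => by rw [horth j i hj, mul_zero]]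
      ring
    rw [inner_sub_left, inner_sub_right, inner_sub_right, h2, h3, h4]
    ring
  have h3 : ‖F - ∑ i ∈ S, c i • e i‖ ^ 2 =
      (⟪F - ∑ i ∈ S, c i • e i, F - ∑ i ∈ S, c i • e i⟫_ℂ).re := by
    rw [inner_self_eq_norm_sq_to_K]
    norm_cast
  rw [h3, h1, Complex.add_re, Complex.add_re]
  refine add_le_add_right ?_ _
  rw [Complex.re_sum, Complex.re_sum]
  refine Finset.sum_le_sum fun i _ => ?_
  rw [inner_self_eq_norm_sq_to_K, Complex.mul_conj]
  have h4 : ‖e i‖ ^ 2 ≤ 1 := pow_le_one₀ (norm_nonneg _) (hnorm i)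
  rw [Complex.ofReal_re, ← RCLike.ofReal_pow]
  change (((Complex.normSq (c i) : ℝ) : ℂ) * ((‖e i‖ ^ 2 : ℝ) : ℂ)).re ≤ _
  rw [← Complex.ofReal_mul, Complex.ofReal_re]
  exact mul_le_of_le_one_right (Complex.normSq_nonneg _) h4

end Hilbert

/-! ### Koopman operators and eigenfunctions -/

section Koopman

variable {G X : Type*} [CommGroup G] [TopologicalSpace G] [TopologicalSpace X]
  [MulAction G X] [ContinuousSMul G X] [MeasurableSpace X] [BorelSpace X]
  {m : Measure X} [SMulInvariantMeasure G X m]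

variable (m) in
/-- The Koopman operator `f ↦ f (t ·)` on `L²`. -/
noncomputable def koopman (t : G) : Lp ℂ 2 m →ₗᵢ[ℂ] Lp ℂ 2 m :=
  Lp.compMeasurePreservingₗᵢ ℂ (fun x => t • x) (measurePreserving_smul t m)

lemma coeFn_koopman (t : G) (f : Lp ℂ 2 m) : koopman m t f =ᵐ[m] fun x => f (t • x) :=
  Lp.coeFn_compMeasurePreserving f (measurePreserving_smul t m)

lemma isEigenfunctionFor_iff {χ : G → ℂ} {f : Lp ℂ 2 m} :
    IsEigenfunctionFor m χ f ↔ f ≠ 0 ∧ ∀ t, koopman m t f = χ t • f := by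
  refine and_congr_right fun _ => forall_congr' fun t => ?_
  rw [Lp.ext_iff]
  constructor
  · intro h
    filter_upwards [h, coeFn_koopman t f, Lp.coeFn_smul (χ t) f] with x h1 h2 h3
    rw [h2, h1, h3]; rfl
  · intro h
    filter_upwards [h, coeFn_koopman t f, Lp.coeFn_smul (χ t) f] with x h1 h2 h3
    rw [← h2, h1, h3]; rfl

/-- Isometry gives ⟪f, g⟫ = conj (ξ t) χ(t) ⟪f, g⟫. Here χ is an arbitrary function, so the lemma
also shows that every eigenvalue is a continuous character once f and g are not orthogonal. -/
lemma inner_eq_zero_of_koopman {χ : G → ℂ} {f g : Lp ℂ 2 m} {ξ : PontryaginDual G}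
    (hf : ∀ t, koopman m t f = charToFun ξ t • f) (hg : ∀ t, koopman m t g = χ t • g)
    (h : χ ≠ charToFun ξ) : ⟪f, g⟫_ℂ = 0 := by
  by_contra H
  refine h (funext fun t => ?_)
  have h1 := (koopman m t).inner_map_map f g
  rw [hf, hg, inner_smul_left, inner_smul_right, ← mul_assoc] at h1
  have h2 := mul_right_cancel₀ H (h1.trans (one_mul _).symm)
  calc χ t = charToFun ξ t * conj (charToFun ξ t) * χ t := by rw [charToFun_mul_conj, one_mul]
    _ = charToFun ξ t := by rw [mul_assoc, h2, mul_one]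

variable [CompactSpace X] [IsFiniteMeasure m]

lemma koopman_toLp (t : G) (f : C(X, ℂ)) :
    koopman m t (ContinuousMap.toLp 2 m ℂ f) = ContinuousMap.toLp 2 m ℂ (translateCM t f) := by
  rw [Lp.ext_iff]
  filter_upwards [coeFn_koopman t (ContinuousMap.toLp 2 m ℂ f),
    ContinuousMap.coeFn_toLp (p := 2) (𝕜 := ℂ) m (translateCM t f),
    (measurePreserving_smul t m).quasiMeasurePreserving.ae
      (ContinuousMap.coeFn_toLp (p := 2) (𝕜 := ℂ) m f)] with x h1 h2 h3
  rw [h1, h2, h3, translateCM_apply]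

lemma integral_mul_conj_eq_inner (e : Lp ℂ 2 m) (f : C(X, ℂ)) :
    ∫ x, f x * conj (e x) ∂m = ⟪e, ContinuousMap.toLp 2 m ℂ f⟫_ℂ := by
  rw [L2.inner_def]
  refine integral_congr_ae ?_
  filter_upwards [ContinuousMap.coeFn_toLp (p := 2) (𝕜 := ℂ) m f] with x hx
  rw [hx, RCLike.inner_apply]

lemma ext_inner_toLp [NormalSpace X] [m.WeaklyRegular] {e e' : Lp ℂ 2 m}
    (h : ∀ f : C(X, ℂ), ⟪e, ContinuousMap.toLp 2 m ℂ f⟫_ℂ = ⟪e', ContinuousMap.toLp 2 m ℂ f⟫_ℂ) :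
    e = e' := by
  refine ext_inner_right ℂ fun v => ?_
  exact (ContinuousMap.toLp_denseRange ℂ m ℂ (by norm_num)).induction
    (by rintro _ ⟨f, rfl⟩; exact h f) (isClosed_eq (by fun_prop) (by fun_prop)) v

end Koopman

/-! ### The vectors representing Fourier coefficients: existence, totality, ergodicity -/

section FourierVectors

variable {G X : Type*} [CommGroup G] [TopologicalSpace G] [IsTopologicalGroup G]
  [MeasurableSpace G] [BorelSpace G] [MetricSpace X] [CompactSpace X] [MeasurableSpace X]
  [BorelSpace X] [MulAction G X] [ContinuousSMul G X]
  {μ : Measure G} [μ.IsHaarMeasure] {B : ℕ → Set G} {p : X}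
  {m : Measure X} [IsProbabilityMeasure m] {a : C(X, ℂ) → PontryaginDual G → ℂ}

omit [IsTopologicalGroup G] [BorelSpace G] [μ.IsHaarMeasure] in
lemma hasMean_orbit_mul_star (hm : IsGenericFor μ B m p) (f : C(X, ℂ)) :
    HasMean μ B (orbitBCF p f * star (orbitBCF p f) : G →ᵇ ℂ)
      ⟪ContinuousMap.toLp 2 m ℂ f, ContinuousMap.toLp 2 m ℂ f⟫_ℂ := by
  rw [ContinuousMap.inner_toLp]
  exact hm (f * star f)

/-- The Fourier coefficients of the orbit functions are represented by vectors in `L²`. -/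
lemma exists_fourierVector (hB : IsFolnerSeq μ B) (hm : IsGenericFor μ B m p)
    (ha : ∀ f ξ, HasMean μ B (orbitBCF p f * star (charBCF ξ) : G →ᵇ ℂ) (a f ξ))
    (ξ : PontryaginDual G) :
    ∃ e : Lp ℂ 2 m, ‖e‖ ≤ 1 ∧ ∀ f, ⟪e, ContinuousMap.toLp 2 m ℂ f⟫_ℂ = a f ξ := by
  let L : C(X, ℂ) →ₗ[ℂ] ℂ :=
    { toFun := fun f => a f ξ
      map_add' := fun f g => by
        refine (ha (f + g) ξ).unique ?_
        have := hasMean_add hB (ha f ξ) (ha g ξ)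
        rwa [← add_mul] at this
      map_smul' := fun c f => by
        refine (ha (c • f) ξ).unique ?_
        have := hasMean_smul (ha f ξ) c
        rwa [← smul_mul_assoc] at this }
  let Ψ : C(X, ℂ) →ₗ[ℂ] Lp ℂ 2 m := (ContinuousMap.toLp 2 m ℂ).toLinearMap
  have hd : DenseRange Ψ := ContinuousMap.toLp_denseRange ℂ m ℂ (by norm_num)
  -- Bessel's inequality, with the quadratic mean of the orbit function identified by genericity as
  -- ‖f‖₂².
  have hb : ∀ f, ‖L f‖ ≤ 1 * ‖Ψ f‖ := by
    intro f
    rw [one_mul, ← sq_le_sq₀ (norm_nonneg _) (norm_nonneg _)]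
    refine (norm_sq_le_of_hasMean hB (ha f) (hasMean_orbit_mul_star hm f) ξ).trans_eq ?_
    rw [inner_self_eq_norm_sq_to_K]
    norm_cast
  refine ⟨(InnerProductSpace.toDual ℂ (Lp ℂ 2 m)).symm (L.extendOfNorm Ψ), ?_, fun f => ?_⟩
  · rw [LinearIsometryEquiv.norm_map]
    exact LinearMap.opNorm_extendOfNorm_le hd zero_le_one hb
  · rw [InnerProductSpace.toDual_symm_apply]
    exact LinearMap.extendOfNorm_eq hd ⟨1, hb⟩ f

variable {e : PontryaginDual G → Lp ℂ 2 m}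

/-- A vector v orthogonal to all e ξ sees only f - ∑ c ξ e ξ, whose norm is at most the
quadratic-mean distance from f_p to P. Hence v is orthogonal to the dense set C(X). -/
lemma fourierVector_total (hB : IsFolnerSeq μ B) (hm : IsGenericFor μ B m p)
    (hp : IsBesicovitchAPPoint μ B p)
    (ha : ∀ f ξ, HasMean μ B (orbitBCF p f * star (charBCF ξ) : G →ᵇ ℂ) (a f ξ))
    (he : ∀ ξ f, ⟪e ξ, ContinuousMap.toLp 2 m ℂ f⟫_ℂ = a f ξ) (hnorm : ∀ ξ, ‖e ξ‖ ≤ 1)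
    (horth : ∀ ξ η, ξ ≠ η → ⟪e ξ, e η⟫_ℂ = 0) (v : Lp ℂ 2 m) (hv : ∀ ξ, ⟪e ξ, v⟫_ℂ = 0) :
    v = 0 := by
  refine ext_inner_toLp fun f => ?_
  rw [inner_zero_left]
  have hsmall : ∀ ε : ℝ, 0 < ε → ‖⟪v, ContinuousMap.toLp 2 m ℂ f⟫_ℂ‖ ≤ ‖v‖ * √ε := by
    intro ε hε
    obtain ⟨P, hP, hPn⟩ := IsBesicovitchAP.exists_trigPoly_sq (h := orbitBCF p f) hB (hp f) hε
    obtain ⟨c, rfl⟩ := mem_trigPoly_iff.1 hP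
    have h1 := tendsto_of_hasMean_mul_star
      (hasMean_sub_trigPoly_sq hB (ha f) (hasMean_orbit_mul_star hm f) c.support c)
    have h2 := le_of_tendsto h1 hPn
    have h3 := norm_sub_sum_sq_le_of_orthogonal horth hnorm (ContinuousMap.toLp 2 m ℂ f)
      c.support c
    simp only [he] at h3
    have h4 : ⟪v, ContinuousMap.toLp 2 m ℂ f⟫_ℂ =
        ⟪v, ContinuousMap.toLp 2 m ℂ f - ∑ ξ ∈ c.support, c ξ • e ξ⟫_ℂ := by
      rw [inner_sub_right, inner_sum, Finset.sum_eq_zero, sub_zero]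
      intro ξ _
      rw [inner_smul_right, inner_eq_zero_symm.1 (hv ξ), mul_zero]
    rw [h4]
    exact (norm_inner_le_norm _ _).trans
      (mul_le_mul_of_nonneg_left (Real.le_sqrt_of_sq_le (h3.trans h2)) (norm_nonneg v))
  have hlim : Tendsto (fun ε : ℝ => ‖v‖ * √ε) (𝓝[>] 0) (𝓝 0) := by
    have : Continuous fun ε : ℝ => ‖v‖ * √ε := by fun_prop
    simpa using (this.tendsto 0).mono_left nhdsWithin_le_nhds
  exact norm_le_zero_iff.1 (ge_of_tendsto hlim (eventually_mem_nhdsWithin.mono hsmall))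

variable [SMulInvariantMeasure G X m]

lemma koopman_fourierVector (hB : IsFolnerSeq μ B)
    (ha : ∀ f ξ, HasMean μ B (orbitBCF p f * star (charBCF ξ) : G →ᵇ ℂ) (a f ξ))
    (he : ∀ ξ f, ⟪e ξ, ContinuousMap.toLp 2 m ℂ f⟫_ℂ = a f ξ) (ξ : PontryaginDual G) (t : G) :
    koopman m t (e ξ) = charToFun ξ t • e ξ := by
  -- The function f_p ξ̄ is the translate by t of ξ(t) times the corresponding product for f(t⁻¹ ·),
  -- so their means agree.
  have htr : ∀ f, a f ξ = charToFun ξ t * a (translateCM t⁻¹ f) ξ := by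
    intro f
    have h1 := (hasMean_smul (ha (translateCM t⁻¹ f) ξ) (charToFun ξ t)).translate hB t
    refine (ha f ξ).unique ?_
    convert h1 using 2 with s
    simp only [BoundedContinuousFunction.mul_apply, BoundedContinuousFunction.star_apply,
      BoundedContinuousFunction.smul_apply, orbitBCF_apply, translateCM_apply, charBCF_apply,
      charToFun_map_mul, star_mul', smul_eq_mul, mul_smul, inv_smul_smul, RCLike.star_def]
    linear_combination -(f (s • p) * conj (charToFun ξ s)) * charToFun_mul_conj ξ t
  refine ext_inner_toLp fun f => ?_
  have h2 : ContinuousMap.toLp 2 m ℂ f =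
      koopman m t (ContinuousMap.toLp 2 m ℂ (translateCM t⁻¹ f)) := by
    rw [koopman_toLp]
    congr 1
    ext x
    simp
  conv_lhs => rw [h2]
  rw [LinearIsometry.inner_map_map, he, inner_smul_left, he, htr f]
  linear_combination -a (translateCM t⁻¹ f) ξ * charToFun_mul_conj ξ t

omit [IsTopologicalGroup G] in
lemma ergodicSMul_of_fourierVector_total
    (he_one : e 1 = ContinuousMap.toLp 2 m ℂ 1)
    (heig : ∀ ξ t, koopman m t (e ξ) = charToFun ξ t • e ξ)
    (htot : ∀ v : Lp ℂ 2 m, (∀ ξ, ⟪e ξ, v⟫_ℂ = 0) → v = 0) :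
    ErgodicSMul G X m := by
  refine ⟨fun {s} hs hinv => ?_⟩
  set v : Lp ℂ 2 m := indicatorConstLp 2 hs (measure_ne_top m s) (1 : ℂ)
  have hvs : v =ᵐ[m] s.indicator fun _ => (1 : ℂ) := indicatorConstLp_coeFn
  have hU : ∀ t : G, koopman m t v = charToFun (1 : PontryaginDual G) t • v := by
    intro t
    rw [charToFun_one, one_smul, Lp.ext_iff]
    filter_upwards [coeFn_koopman t v, hvs, hinv t,
      (measurePreserving_smul t m).quasiMeasurePreserving.ae hvs] with x h1 h2 h3 h4
    rw [h1, h2, h4]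
    have h5 : t • x ∈ s ↔ x ∈ s := iff_of_eq h3
    by_cases hx : x ∈ s
    · rw [Set.indicator_of_mem hx, Set.indicator_of_mem (h5.2 hx)]
    · rw [Set.indicator_of_notMem hx, Set.indicator_of_notMem fun h => hx (h5.1 h)]
  have horth : ∀ ξ, ξ ≠ 1 → ∀ w : Lp ℂ 2 m,
      (∀ t : G, koopman m t w = charToFun (1 : PontryaginDual G) t • w) → ⟪e ξ, w⟫_ℂ = 0 :=
    fun ξ hξ w hw => inner_eq_zero_of_koopman (heig ξ) hw (charToFun_injective.ne hξ.symm)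
  have hone : ⟪e 1, e 1⟫_ℂ = 1 := by
    rw [he_one, ContinuousMap.inner_toLp]
    simp
  -- Both v and e 1 are invariant, hence orthogonal to e ξ for ξ ≠ 1; by totality v equals its
  -- projection onto the constants.
  have hv : v = ⟪e 1, v⟫_ℂ • e 1 := by
    refine sub_eq_zero.1 (htot _ fun ξ => ?_)
    rw [inner_sub_right, inner_smul_right]
    by_cases hξ : ξ = 1
    · rw [hξ, hone, mul_one, sub_self]
    · rw [horth ξ hξ v hU, horth ξ hξ _ (heig 1), mul_zero, sub_zero]
  have hconst : s.indicator (fun _ => (1 : ℂ)) =ᵐ[m] fun _ => ⟪e 1, v⟫_ℂ := by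
    have h1 := Lp.ext_iff.1 hv
    filter_upwards [hvs, h1, Lp.coeFn_smul ⟪e 1, v⟫_ℂ (e 1),
      he_one ▸ ContinuousMap.coeFn_toLp (p := 2) (𝕜 := ℂ) m 1] with x h2 h3 h4 h5
    rw [← h2, h3, h4, Pi.smul_apply, h5]
    simp
  rw [eventuallyConst_set]
  by_cases hc : ⟪e 1, v⟫_ℂ = 1
  · left
    filter_upwards [hconst] with x hx
    by_contra hxs
    rw [Set.indicator_of_notMem hxs, hc] at hx
    exact zero_ne_one hx
  · right
    filter_upwards [hconst] with x hx hxs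
    rw [Set.indicator_of_mem hxs] at hx
    exact hc hx.symm

end FourierVectors

/-! ### The main theorem -/

theorem mainTheorem3 {G X : Type*}
    [CommGroup G] [TopologicalSpace G] [IsTopologicalGroup G] [T2Space G]
    [LocallyCompactSpace G] [SigmaCompactSpace G] [MeasurableSpace G] [BorelSpace G]
    [MetricSpace X] [CompactSpace X] [MeasurableSpace X] [BorelSpace X]
    [MulAction G X] [ContinuousSMul G X]
    (μ : Measure G) [μ.IsHaarMeasure] [μ.Regular]
    (B : ℕ → Set G) (hB : IsFolnerSeq μ B)
    (p : X) (hp : IsBesicovitchAPPoint μ B p) :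
    (∀ (f : C(X, ℂ)) (ξ : PontryaginDual G),
      ∃ a : ℂ, HasMean μ B (fun t => f (t • p) * conj (charToFun ξ t)) a) ∧
    ∃ m : Measure X,
      (IsProbabilityMeasure m ∧ ErgodicSMul G X m ∧ IsGenericFor μ B m p) ∧
      (∀ m' : Measure X,
        IsProbabilityMeasure m' → ErgodicSMul G X m' → IsGenericFor μ B m' p → m' = m) ∧
      HasPurePointSpectrum G m ∧
      Eig G m = charToFun '' Freq μ B p ∧
      ∀ ξ : PontryaginDual G, charToFun ξ ∈ Eig G m →
        ∃! e : Lp ℂ 2 m, IsEigenfunctionFor m (charToFun ξ) e ∧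
          ∀ f : C(X, ℂ),
            HasMean μ B (fun t => f (t • p) * conj (charToFun ξ t))
              (∫ x, f x * conj (e x) ∂m) := by
  have hmean : ∀ (f : C(X, ℂ)) (ξ : PontryaginDual G), ∃ a : ℂ,
      HasMean μ B (orbitBCF p f * star (charBCF ξ) : G →ᵇ ℂ) a := fun f ξ =>
    IsBesicovitchAP.exists_hasMean hB (hp f) ξ
  refine ⟨hmean, ?_⟩
  obtain ⟨m, hprob, hgen⟩ := exists_isGenericFor (p := p) hB fun f => by
    simpa [charBCF_one] using hmean f 1
  have hinv := hgen.smulInvariantMeasure hB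
  choose a ha using hmean
  choose e hnorm he using exists_fourierVector hB hgen ha
  have heig := koopman_fourierVector hB ha he
  have horth : ∀ ξ η, ξ ≠ η → ⟪e ξ, e η⟫_ℂ = 0 := fun ξ η h =>
    inner_eq_zero_of_koopman (heig ξ) (heig η) (charToFun_injective.ne h.symm)
  have htot := fourierVector_total hB hgen hp ha he hnorm horth
  have he_one : e 1 = ContinuousMap.toLp 2 m ℂ 1 := by
    refine ext_inner_toLp fun f => ?_
    rw [he, ContinuousMap.inner_toLp]
    refine (ha f 1).unique ?_
    simpa [charBCF_one] using! hgen f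
  have hne : ∀ ξ, ξ ∈ Freq μ B p ↔ e ξ ≠ 0 := by
    intro ξ
    constructor
    · rintro ⟨f, b, hb, hb0⟩ h0
      refine hb0 (hb.unique ?_)
      have h1 := ha f ξ
      rwa [← he, h0, inner_zero_left] at h1
    · intro h
      by_contra hξ
      refine h (ext_inner_toLp fun f => ?_)
      rw [inner_zero_left, he]
      by_contra h0
      exact hξ ⟨f, _, ha f ξ, h0⟩
  have hEig : Eig G m = charToFun '' Freq μ B p := by
    ext χ
    constructor
    · rintro ⟨f, hf⟩
      rw [isEigenfunctionFor_iff] at hf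
      -- By totality f is not orthogonal to every e ξ; an eigenvalue χ different from ξ would force
      -- orthogonality.
      obtain ⟨ξ, hξ⟩ : ∃ ξ, ⟪e ξ, f⟫_ℂ ≠ 0 := by
        by_contra! H
        exact hf.1 (htot f H)
      refine ⟨ξ, (hne ξ).2 fun h => hξ (by rw [h, inner_zero_left]), ?_⟩
      by_contra hχ
      exact hξ (inner_eq_zero_of_koopman (heig ξ) hf.2 (Ne.symm hχ))
    · rintro ⟨ξ, hξ, rfl⟩
      exact ⟨e ξ, isEigenfunctionFor_iff.2 ⟨(hne ξ).1 hξ, heig ξ⟩⟩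
  refine ⟨m, ⟨hprob, ergodicSMul_of_fourierVector_total he_one heig htot, hgen⟩,
    fun m' _ _ hm' => hm'.ext hgen, ?_, hEig, fun ξ hξ => ?_⟩
  · obtain ⟨s, b, hb, hs⟩ := exists_hilbertBasis_of_orthogonal horth htot
    refine ⟨s, b, hb, fun f hf => ?_⟩
    obtain ⟨ξ, c, hf0, rfl⟩ := hs f hf
    refine ⟨charToFun ξ, isEigenfunctionFor_iff.2 ⟨hf0, fun t => ?_⟩⟩
    rw [map_smul, heig, smul_comm]
  · rw [hEig, charToFun_injective.mem_set_image, hne] at hξ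
    refine ⟨e ξ, ⟨isEigenfunctionFor_iff.2 ⟨hξ, heig ξ⟩, fun f => ?_⟩, fun e' he' => ?_⟩
    · rw [integral_mul_conj_eq_inner, he]
      exact ha f ξ
    · refine ext_inner_toLp fun f => ?_
      rw [← integral_mul_conj_eq_inner, he]
      exact (he'.2 f).unique (ha f ξ)
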